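/- **Theorem (Signed Mahonian of type $D$).** For $n\ge 1$ let $B_n$ be the group of bijections $\beta$ of $\{-n,\dots,-1,1,\dots,n\}$ with $\beta(-i)=-\beta(i)$, written $\beta=[\beta(1),\dots,\beta(n)]$, and let $D_n\subseteq B_n$ be the subgroup of those $\gamma$ for which the number of $i\in\{1,\dots,n\}$ with $\gamma(i)<0$ is even. Let $\ell_D$ be the length function of $D_n$ with respect to the Coxeter generators $s_i=[1,\dots,i-1,i+1,i,i+2,\dots,n]$ for $1\le i\le n-1$ and, if $n\ge 2$, $s_0=[-2,-1,3,\dots,n]$ (so $\ell_D(\gamma)$ is the least number of generators whose product is $\gamma$; for $n=1$ the group $D_1$ is trivial and there are no generators). For a finite integer sequence $\sigma=(\sigma_1,\dots,\sigma_n)$ put $\operatorname{fmaj}(\sigma)=2\operatorname{maj}(\sigma)+|\{i:\sigma_i<0\}|$, where $\operatorname{maj}(\sigma)$ is the sum of all $i\in\{1,\dots,n-1\}$ with $\sigma_{i+1}\prec\sigma_i$ in the order $-1\prec-2\prec\cdots\prec-n\prec\cdots\prec0\prec1\prec2\prec\cdots\prec n\prec\cdots$ on $\mathbb Z$. For $\gamma\in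 D_n$ put $\operatorname{Dmaj}(\gamma)=\operatorname{fmaj}(\gamma(1),\dots,\gamma(n-1),|\gamma(n)|)$. For an integer $m\ge 1$ put $[m]_q=\frac{1-q^m}{1-q}=1+q+\cdots+q^{m-1}$, and let $[m]_{-q}$ be the result of substituting $-q$ for $q$. Then for every $n\ge 1$, as polynomials in $q$ with integer coefficients, $$\sum_{\gamma\in D_n}(-1)^{\ell_D(\gamma)}q^{\operatorname{Dmaj}(\gamma)}=\Bigl(\prod_{k=1}^{n-1}[2k]_{(-1)^kq}\Bigr)[n]_q .$$ That is, the sum equals $[2]_{-q}[4]_q\cdots[2n-2]_{-q}[n]_q$ if $n$ is even and $[2]_{-q}[4]_q\cdots[2n-2]_q\,[n]_q$ if $n$ is odd (for $n=1$ the product over $k$ is empty and the sum is $1$). -/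

import Mathlib

open Polynomial

/-- The underlying set `[-n, n] \ {0}` on which signed permutations act. -/
abbrev SignedIndex (n : ℕ) : Type :=
  {z : ℤ // z ∈ (Finset.Icc (-(n : ℤ)) (n : ℤ)).erase 0}

namespace SignedIndex

/-- The involution `x ↦ -x` of `[-n, n] \ {0}`. -/
instance instNeg (n : ℕ) : Neg (SignedIndex n) where
  neg x := ⟨-x.1, by
    have hx := x.2
    simp only [Finset.mem_erase, Finset.mem_Icc, ne_eq] at hx ⊢
    omega⟩

/-- The positive element `i + 1` of `[-n, n] \ {0}`, for `0 ≤ i < n`; thus `pos` enumerates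
`1, …, n`. -/
def pos {n : ℕ} (i : Fin n) : SignedIndex n :=
  ⟨(i : ℤ) + 1, by
    have hi := i.2
    simp only [Finset.mem_erase, Finset.mem_Icc, ne_eq]
    omega⟩

end SignedIndex

/-- The hyperoctahedral group `B_n`: the permutations `β` of `[-n, n] \ {0}` with
`β (-x) = -β x`, under composition. -/
def Hyperoctahedral (n : ℕ) : Subgroup (Equiv.Perm (SignedIndex n)) where
  carrier := {β | ∀ x, β (-x) = -β x}
  one_mem' := fun _ => rfl
  mul_mem' := by
    intro a b ha hb x
    rw [Equiv.Perm.mul_apply, Equiv.Perm.mul_apply, hb x, ha (b x)]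
  inv_mem' := by
    intro a ha x
    rw [Equiv.Perm.inv_eq_iff_eq, ha, show a (a⁻¹ x) = x from a.apply_symm_apply x]

noncomputable instance Hyperoctahedral.instDecidableMem (n : ℕ) :
    DecidablePred (· ∈ Hyperoctahedral n) :=
  fun β => inferInstanceAs (Decidable (∀ x, β (-x) = -β x))

/-- The window notation `[β(1), …, β(n)]`; the entry `β(i)` stands at the index `i - 1`. -/
def window {n : ℕ} (β : Hyperoctahedral n) (i : Fin n) : ℤ :=
  ((β : Equiv.Perm (SignedIndex n)) (SignedIndex.pos i) : ℤ)

/-- The number `N₁` of negative entries of a sequence. -/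
def negCount {n : ℕ} (σ : Fin n → ℤ) : ℕ :=
  (Finset.univ.filter fun i : Fin n => σ i < 0).card

/-- The strict linear order `-1 ≺ -2 ≺ ⋯ ≺ -n ≺ ⋯ ≺ 0 ≺ 1 ≺ 2 ≺ ⋯` on `ℤ`. -/
def FlagLT (a b : ℤ) : Prop :=
  if a < 0 ∧ b < 0 then b < a else a < b

instance FlagLT.instDecidable (a b : ℤ) : Decidable (FlagLT a b) :=
  inferInstanceAs (Decidable (if a < 0 ∧ b < 0 then b < a else a < b))

/-- The descents of a sequence with respect to `≺`, as (zero-based) indices. -/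
def flagDescents {n : ℕ} (σ : Fin n → ℤ) : Finset (Fin n) :=
  Finset.univ.filter fun i => ∃ j : Fin n, (j : ℕ) = (i : ℕ) + 1 ∧ FlagLT (σ j) (σ i)

/-- The major index with respect to `≺`: the sum of the (one-based) positions of descents. -/
def flagMaj {n : ℕ} (σ : Fin n → ℤ) : ℕ :=
  ∑ i ∈ flagDescents σ, ((i : ℕ) + 1)

/-- The flag-major index `fmaj = 2 maj + N₁`, as a function of the window. -/
def fmaj {n : ℕ} (σ : Fin n → ℤ) : ℕ :=
  2 * flagMaj σ + negCount σ

/-- The sequence with its last entry replaced by its absolute value. -/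
def absLast {n : ℕ} (σ : Fin n → ℤ) (i : Fin n) : ℤ :=
  if (i : ℕ) + 1 = n then |σ i| else σ i

/-- The `D`-major index of a signed permutation: `fmaj [γ(1), …, γ(n-1), |γ(n)|]`. -/
def Dmaj {n : ℕ} (γ : Hyperoctahedral n) : ℕ :=
  fmaj (absLast (window γ))

/-- `D_n`: the signed permutations with an even number of negative window entries. -/
noncomputable def evenSigned (n : ℕ) : Finset (Hyperoctahedral n) :=
  Finset.univ.filter fun γ => Even (negCount (window γ))

/-- The Coxeter generators of `D_n`: the elements
`s_i = [1, …, i-1, i+1, i, i+2, …, n]` for `1 ≤ i ≤ n - 1`, and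
`s_0 = [-2, -1, 3, …, n]` (there are none if `n ≤ 1`). -/
def simpleReflectionsD (n : ℕ) : Set (Hyperoctahedral n) :=
  {s | (∃ i j : Fin n, (j : ℕ) = (i : ℕ) + 1 ∧
          (s : Equiv.Perm (SignedIndex n)) =
            Equiv.swap (SignedIndex.pos i) (SignedIndex.pos j) *
              Equiv.swap (-SignedIndex.pos i) (-SignedIndex.pos j)) ∨
       (∃ i j : Fin n, (i : ℕ) = 0 ∧ (j : ℕ) = 1 ∧
          (s : Equiv.Perm (SignedIndex n)) =
            Equiv.swap (SignedIndex.pos i) (-SignedIndex.pos j) *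
              Equiv.swap (SignedIndex.pos j) (-SignedIndex.pos i))}

/-- The length `ℓ_D` of an element of `D_n`: the least length of a word in the Coxeter
generators of `D_n` that represents it. -/
noncomputable def lengthD {n : ℕ} (γ : Hyperoctahedral n) : ℕ :=
  sInf {k : ℕ | ∃ w : List (Hyperoctahedral n),
    (∀ s ∈ w, s ∈ simpleReflectionsD n) ∧ w.prod = γ ∧ w.length = k}

/-- The `q`-integer `[m]_q = 1 + q + ⋯ + q^(m-1) = (1 - q^m) / (1 - q)`. -/
def qInt {R : Type*} [CommRing R] (m : ℕ) (q : R) : R :=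
  ∑ i ∈ Finset.range m, q ^ i

/-!
# The signed Mahonian identity of type `D`

The proof passes from `D_n` to `B_n`, where a cyclic rotation of the letters computes the sum.

*Sign.* Both kinds of generators of `D_n` project to transpositions under `β ↦ |β|`, so
`(-1) ^ lengthD γ = sgn |γ|` (`neg_one_pow_lengthD`). As `lengthD` is an infimum over words, this
uses that `D_n` is generated by them: in a coset `β H` of the generated submonoid `H`, an element
maximising `∑ i β(i)` has an increasing positive window, so it is the identity (`exists_prod_eq`).

*Reduction.* Making the last entry positive is a bijection from `D_n` onto
`{β ∈ B_n : β(n) > 0}` that keeps `|γ|` and turns `Dmaj` into `fmaj` (`sum_evenSigned`).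

*Rotation.* Let `c` be the rotation `1 ↦ 2 ↦ ⋯ ↦ n ↦ -1 ↦ ⋯ ↦ -n ↦ 1`. It preserves `≺` except
that the greatest letter `n` becomes the least letter `-1`. If `β(n) ≠ n`, then
`fmaj (c β) = fmaj β - 1`: when `n` occurs, one descent moves one place to the left and one sign
appears; when `-n` occurs, the descents stay and one sign disappears (`fmaj_rotVal`). Moreover `|c|`
is an `n`-cycle. So each step of the orbit `n, n - 1, …, 1, -n, …, -1` of last entries multiplies
the signed sum over a fibre by `(-1) ^ (n - 1) * q`, and the fibre over `n` is `B_{n-1}`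
(`lastSum_orbitLetter`, `lastSum_top`). The whole orbit gives the factor `[2n]` in the formula for
`B_n` (`signedSum_eq_prod`), and its positive half, for `D_n`, gives `[n]` (`sum_weight_last_pos`),
both at `(-1) ^ (n - 1) * q`.

*Comparison.* This yields `∏_{k < n} [2k]` at `(-1) ^ (k - 1) * q` times `[n]` at
`(-1) ^ (n - 1) * q`. Since `[2k]_y = (1 + y) [k]_{y²}`, all signs of `q` can be switched
(`prod_qInt_mul_qInt`).
-/

/-! ### The action of `B_n` on absolute values -/

namespace SignedIndex

variable {n : ℕ}

lemma bounds (x : SignedIndex n) : x.1 ≠ 0 ∧ -(n : ℤ) ≤ x.1 ∧ x.1 ≤ n := by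
  have hx := x.2
  simp only [Finset.mem_erase, Finset.mem_Icc, ne_eq] at hx
  exact hx

@[simp] lemma coe_neg (x : SignedIndex n) : ((-x : SignedIndex n) : ℤ) = -(x : ℤ) := rfl

@[simp] lemma coe_pos (i : Fin n) : ((pos i : SignedIndex n) : ℤ) = (i : ℤ) + 1 := rfl

/-- The index `i` with `x = ±(i + 1)`. -/
def idx (x : SignedIndex n) : Fin n :=
  ⟨x.1.natAbs - 1, by have := x.bounds; omega⟩

lemma coe_idx (x : SignedIndex n) : ((idx x : ℕ) : ℤ) = |x.1| - 1 := by
  have := x.bounds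
  simp only [idx, Int.abs_eq_natAbs]
  omega

@[simp] lemma idx_pos (i : Fin n) : idx (pos i) = i := by
  apply Fin.ext
  simp only [idx, coe_pos]
  omega

@[simp] lemma idx_neg (x : SignedIndex n) : idx (-x) = idx x := by
  apply Fin.ext
  simp [idx]

lemma eq_pos_or_eq_neg_pos (x : SignedIndex n) : x = pos (idx x) ∨ x = -pos (idx x) := by
  have := x.bounds
  have := x.coe_idx
  rcases le_total 0 x.1 with h | h
  · left
    apply Subtype.ext
    rw [coe_pos]
    rw [abs_of_nonneg h] at this
    omega
  · right
    apply Subtype.ext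
    rw [coe_neg, coe_pos]
    rw [abs_of_nonpos h] at this
    omega

lemma pos_ne_neg_pos (i j : Fin n) : pos i ≠ -pos j := by
  intro h
  have := congrArg Subtype.val h
  simp at this
  omega

lemma pos_injective : Function.Injective (pos : Fin n → SignedIndex n) := fun i j h => by
  simpa using congrArg idx h

end SignedIndex

namespace Hyperoctahedral

open SignedIndex

variable {n : ℕ}

@[simp] lemma apply_neg (β : Hyperoctahedral n) (x : SignedIndex n) :
    (β : Equiv.Perm (SignedIndex n)) (-x) = -(β : Equiv.Perm (SignedIndex n)) x := β.2 x

/-- The absolute value of `β x` depends only on that of `x`. -/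
lemma idx_apply (β : Hyperoctahedral n) (x : SignedIndex n) :
    idx ((β : Equiv.Perm (SignedIndex n)) x) =
      idx ((β : Equiv.Perm (SignedIndex n)) (pos (idx x))) := by
  rcases eq_pos_or_eq_neg_pos x with h | h
  · rw [← h]
  · conv_lhs => rw [h]
    rw [apply_neg, idx_neg]

/-- The projection `β ↦ |β|` of `B_n` onto the symmetric group. -/
def absPerm : Hyperoctahedral n →* Equiv.Perm (Fin n) :=
  MonoidHom.toHomPerm
    { toFun := fun β i => idx ((β : Equiv.Perm (SignedIndex n)) (pos i))
      map_one' := funext fun i => idx_pos i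
      map_mul' := by
        intro a b
        funext i
        simp only [Subgroup.coe_mul, Equiv.Perm.mul_apply]
        rw [idx_apply a]
        rfl }

@[simp] lemma absPerm_apply (β : Hyperoctahedral n) (i : Fin n) :
    absPerm β i = idx ((β : Equiv.Perm (SignedIndex n)) (pos i)) := rfl

/-- The character `β ↦ sgn |β|` of `B_n`. -/
def absSign : Hyperoctahedral n →* ℤˣ := Equiv.Perm.sign.comp absPerm

lemma absSign_apply (β : Hyperoctahedral n) : absSign β = Equiv.Perm.sign (absPerm β) := rfl

lemma coe_absPerm (β : Hyperoctahedral n) (i : Fin n) :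
    ((absPerm β i : ℕ) : ℤ) + 1 = |window β i| := by
  rw [absPerm_apply, coe_idx, window]
  ring

lemma window_bounds (β : Hyperoctahedral n) (i : Fin n) :
    window β i ≠ 0 ∧ -(n : ℤ) ≤ window β i ∧ window β i ≤ n :=
  bounds _

lemma abs_window_injective (β : Hyperoctahedral n) :
    Function.Injective fun i => |window β i| := fun i j h => by
  apply (absPerm β).injective
  apply Fin.ext
  have h1 := coe_absPerm β i
  have h2 := coe_absPerm β j
  simp only at h
  omega

/-- A signed permutation is determined by its window. -/
lemma window_injective : Function.Injective (window : Hyperoctahedral n → Fin n → ℤ) := by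
  intro a b h
  have key (i : Fin n) : (a : Equiv.Perm (SignedIndex n)) (pos i) =
      (b : Equiv.Perm (SignedIndex n)) (pos i) := Subtype.ext (congrFun h i)
  apply Subtype.ext
  ext1 x
  rcases eq_pos_or_eq_neg_pos x with h | h
  · rw [h, key]
  · rw [h, apply_neg, apply_neg, key]

@[simp] lemma window_one (i : Fin n) : window (1 : Hyperoctahedral n) i = (i : ℤ) + 1 := rfl

/-! ### The sign of an element of `D_n` -/

lemma window_mul_of_eq_pos (β s : Hyperoctahedral n) {i j : Fin n}
    (h : (s : Equiv.Perm (SignedIndex n)) (pos i) = pos j) :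
    window (β * s) i = window β j := by
  simp [window, h]

lemma window_mul_of_eq_neg_pos (β s : Hyperoctahedral n) {i j : Fin n}
    (h : (s : Equiv.Perm (SignedIndex n)) (pos i) = -pos j) :
    window (β * s) i = -window β j := by
  simp [window, h]

section Reflections

variable {i j : Fin n}

/-- The reflection `s_{ij}` exchanging `i` with `j` and `-i` with `-j`. -/
def swapPos (i j : Fin n) : Equiv.Perm (SignedIndex n) :=
  Equiv.swap (pos i) (pos j) * Equiv.swap (-pos i) (-pos j)

/-- The reflection exchanging `i` with `-j` and `j` with `-i`. -/
def swapNeg (i j : Fin n) : Equiv.Perm (SignedIndex n) :=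
  Equiv.swap (pos i) (-pos j) * Equiv.swap (pos j) (-pos i)

lemma neg_eq_neg_iff (x y : SignedIndex n) : -x = -y ↔ x = y := by
  rw [Subtype.ext_iff, Subtype.ext_iff, coe_neg, coe_neg, neg_inj]

lemma swapPos_pos (k : Fin n) : swapPos i j (pos k) = pos (Equiv.swap i j k) := by
  rw [swapPos, Equiv.Perm.mul_apply, Equiv.swap_apply_of_ne_of_ne (pos_ne_neg_pos _ _)
    (pos_ne_neg_pos _ _), pos_injective.swap_apply]

lemma swapNeg_pos (hij : i ≠ j) (k : Fin n) : swapNeg i j (pos k) =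
    if k = i ∨ k = j then -pos (Equiv.swap i j k) else pos k := by
  have hp := pos_injective.ne hij
  have hn : -pos i ≠ -pos j := fun h => hp ((neg_eq_neg_iff _ _).1 h)
  rw [swapNeg, Equiv.Perm.mul_apply]
  by_cases hi : k = i
  · subst hi
    rw [Equiv.swap_apply_of_ne_of_ne hp (pos_ne_neg_pos _ _)]
    simp
  by_cases hj : k = j
  · subst hj
    rw [Equiv.swap_apply_left, Equiv.swap_apply_of_ne_of_ne (pos_ne_neg_pos _ _).symm hn]
    simp
  · rw [Equiv.swap_apply_of_ne_of_ne (pos_injective.ne hj) (pos_ne_neg_pos _ _),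
      Equiv.swap_apply_of_ne_of_ne (pos_injective.ne hi) (pos_ne_neg_pos _ _)]
    simp [hi, hj]

lemma swapPos_mem : swapPos i j ∈ Hyperoctahedral n := by
  intro x
  have hneg (y z w : SignedIndex n) :
      Equiv.swap (-y) (-z) (-w) = -Equiv.swap y z w := by
    have hinj : Function.Injective (fun x : SignedIndex n => -x) :=
      fun a b h => (neg_eq_neg_iff a b).1 h
    exact hinj.swap_apply y z w
  have hnn (y : SignedIndex n) : - -y = y := Subtype.ext (neg_neg _)
  rcases eq_pos_or_eq_neg_pos x with h | h <;> rw [h]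
  · rw [swapPos_pos, swapPos, Equiv.Perm.mul_apply, hneg, pos_injective.swap_apply,
      Equiv.swap_apply_of_ne_of_ne (pos_ne_neg_pos _ _).symm (pos_ne_neg_pos _ _).symm]
  · rw [hnn, swapPos_pos, swapPos, Equiv.Perm.mul_apply, hneg, pos_injective.swap_apply,
      Equiv.swap_apply_of_ne_of_ne (pos_ne_neg_pos _ _).symm (pos_ne_neg_pos _ _).symm, hnn]

lemma swapNeg_mem (hij : i ≠ j) : swapNeg i j ∈ Hyperoctahedral n := by
  have hp := pos_injective.ne hij
  have hn : -pos i ≠ -pos j := fun h => hp ((neg_eq_neg_iff _ _).1 h)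
  have hnn (y : SignedIndex n) : - -y = y := Subtype.ext (neg_neg _)
  have key (k : Fin n) : swapNeg i j (-pos k) = - swapNeg i j (pos k) := by
    rw [swapNeg_pos hij, swapNeg, Equiv.Perm.mul_apply]
    by_cases hi : k = i
    · subst hi
      rw [Equiv.swap_apply_right, Equiv.swap_apply_of_ne_of_ne hp.symm (pos_ne_neg_pos _ _)]
      simp [hnn]
    by_cases hj : k = j
    · subst hj
      rw [Equiv.swap_apply_of_ne_of_ne (pos_ne_neg_pos _ _).symm hn.symm, Equiv.swap_apply_right]
      simp [hnn]
    · have h1 : -pos k ≠ -pos i := fun h => hi (pos_injective ((neg_eq_neg_iff _ _).1 h))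
      have h2 : -pos k ≠ -pos j := fun h => hj (pos_injective ((neg_eq_neg_iff _ _).1 h))
      rw [Equiv.swap_apply_of_ne_of_ne (pos_ne_neg_pos _ _).symm h1,
        Equiv.swap_apply_of_ne_of_ne (pos_ne_neg_pos _ _).symm h2]
      simp [hi, hj]
  intro x
  rcases eq_pos_or_eq_neg_pos x with h | h <;> rw [h]
  · exact key _
  · rw [key, hnn, hnn]

end Reflections

lemma mem_simpleReflectionsD {s : Hyperoctahedral n} : s ∈ simpleReflectionsD n ↔
    (∃ i j : Fin n, (j : ℕ) = (i : ℕ) + 1 ∧ (s : Equiv.Perm (SignedIndex n)) = swapPos i j) ∨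
    (∃ i j : Fin n, (i : ℕ) = 0 ∧ (j : ℕ) = 1 ∧
      (s : Equiv.Perm (SignedIndex n)) = swapNeg i j) := Iff.rfl

lemma absSign_simpleReflection {s : Hyperoctahedral n} (hs : s ∈ simpleReflectionsD n) :
    absSign s = -1 := by
  suffices ∃ i j : Fin n, i ≠ j ∧ absPerm s = Equiv.swap i j by
    obtain ⟨i, j, hij, h⟩ := this
    rw [absSign_apply, h, Equiv.Perm.sign_swap hij]
  rcases mem_simpleReflectionsD.1 hs with ⟨i, j, hij, h⟩ | ⟨i, j, hi, hj, h⟩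
  · refine ⟨i, j, fun e => by subst e; omega, Equiv.ext fun k => ?_⟩
    rw [absPerm_apply, h, swapPos_pos, idx_pos]
  · have hne : i ≠ j := fun e => by subst e; omega
    refine ⟨i, j, hne, Equiv.ext fun k => ?_⟩
    rw [absPerm_apply, h, swapNeg_pos hne]
    split_ifs with hk
    · simp
    · push Not at hk
      rw [idx_pos, Equiv.swap_apply_of_ne_of_ne hk.1 hk.2]

lemma absSign_prod (w : List (Hyperoctahedral n)) (hw : ∀ s ∈ w, s ∈ simpleReflectionsD n) :
    absSign w.prod = (-1) ^ w.length := by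
  induction w with
  | nil => simp
  | cons s w ih =>
    rw [List.prod_cons, map_mul, ih fun t ht => hw t (List.mem_cons_of_mem _ ht),
      absSign_simpleReflection (hw s List.mem_cons_self), List.length_cons, pow_succ']

lemma natCast_negCount (σ : Fin n → ℤ) : (negCount σ : ℤ) = ∑ k, if σ k < 0 then 1 else 0 :=
  Finset.natCast_card_filter _ _

/-- Multiplication by a generator of `D_n` preserves `D_n`. -/
lemma even_negCount_mul {s : Hyperoctahedral n} (hs : s ∈ simpleReflectionsD n)
    (β : Hyperoctahedral n) :
    Even (negCount (window (β * s))) ↔ Even (negCount (window β)) := by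
  rw [← Int.even_coe_nat, ← Int.even_coe_nat (negCount (window β)), ← Int.even_sub,
    natCast_negCount, natCast_negCount, ← Finset.sum_sub_distrib]
  rcases mem_simpleReflectionsD.1 hs with ⟨i, j, hij, h⟩ | ⟨i, j, hi, hj, h⟩
  · have hne : i ≠ j := fun e => by subst e; omega
    have hw (k : Fin n) : window (β * s) k = window β (Equiv.swap i j k) :=
      window_mul_of_eq_pos _ _ (by rw [h, swapPos_pos])
    rw [Finset.sum_eq_add i j hne (fun k _ hk => ?_) (by simp) (by simp)]
    · rw [hw, hw, Equiv.swap_apply_left, Equiv.swap_apply_right]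
      simp
    · rw [hw, Equiv.swap_apply_of_ne_of_ne hk.1 hk.2, sub_self]
  · have hne : i ≠ j := fun e => by subst e; omega
    have hwi : window (β * s) i = -window β j :=
      window_mul_of_eq_neg_pos _ _ (by rw [h, swapNeg_pos hne]; simp)
    have hwj : window (β * s) j = -window β i :=
      window_mul_of_eq_neg_pos _ _ (by rw [h, swapNeg_pos hne]; simp)
    rw [Finset.sum_eq_add i j hne (fun k _ hk => ?_) (by simp) (by simp)]
    · have h1 := (window_bounds β i).1
      have h2 := (window_bounds β j).1
      rw [hwi, hwj, Int.even_iff]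
      split_ifs <;> omega
    · rw [window_mul_of_eq_pos β s (j := k) (by rw [h, swapNeg_pos hne]; simp [hk.1, hk.2]),
        sub_self]

/-- The weight `∑ i β(i)`, which is maximal on `B_n` at the identity. -/
def moment (β : Hyperoctahedral n) : ℤ := ∑ k : Fin n, ((k : ℤ) + 1) * window β k

/-- A descent `β(i) > β(i + 1)` lets `s_i` increase the moment. -/
lemma moment_lt_mul_swapPos {β s : Hyperoctahedral n} {i j : Fin n} (hij : (j : ℕ) = i + 1)
    (hs : (s : Equiv.Perm (SignedIndex n)) = swapPos i j) (h : window β j < window β i) :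
    moment β < moment (β * s) := by
  have hne : i ≠ j := fun e => by subst e; omega
  have hw (k : Fin n) : window (β * s) k = window β (Equiv.swap i j k) :=
    window_mul_of_eq_pos _ _ (by rw [hs, swapPos_pos])
  rw [← sub_pos, moment, moment, ← Finset.sum_sub_distrib,
    Finset.sum_eq_add i j hne (fun k _ hk => ?_) (by simp) (by simp)]
  · rw [hw, hw, Equiv.swap_apply_left, Equiv.swap_apply_right, hij]
    push_cast
    linarith
  · rw [hw, Equiv.swap_apply_of_ne_of_ne hk.1 hk.2, sub_self]

/-- If `β(1) + β(2) < 0` then `s_0` increases the moment, by `-3 (β(1) + β(2))`. -/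
lemma moment_lt_mul_swapNeg {β s : Hyperoctahedral n} {i j : Fin n} (hi : (i : ℕ) = 0)
    (hj : (j : ℕ) = 1) (hs : (s : Equiv.Perm (SignedIndex n)) = swapNeg i j)
    (h : window β i + window β j < 0) :
    moment β < moment (β * s) := by
  have hne : i ≠ j := fun e => by subst e; omega
  have hwi : window (β * s) i = -window β j :=
    window_mul_of_eq_neg_pos _ _ (by rw [hs, swapNeg_pos hne]; simp)
  have hwj : window (β * s) j = -window β i :=
    window_mul_of_eq_neg_pos _ _ (by rw [hs, swapNeg_pos hne]; simp)
  rw [← sub_pos, moment, moment, ← Finset.sum_sub_distrib,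
    Finset.sum_eq_add i j hne (fun k _ hk => ?_) (by simp) (by simp)]
  · rw [hwi, hwj, hi, hj]
    push_cast
    linarith
  · rw [window_mul_of_eq_pos β s (j := k) (by rw [hs, swapNeg_pos hne]; simp [hk.1, hk.2]),
      sub_self]

/-- An element of `D_n` whose moment no generator increases has an increasing window that is
positive, so it is the identity. -/
lemma eq_one_of_moment_le {β : Hyperoctahedral n} (hβ : Even (negCount (window β)))
    (h : ∀ s ∈ simpleReflectionsD n, moment (β * s) ≤ moment β) : β = 1 := by
  have hstep (i j : Fin n) (hij : (j : ℕ) = i + 1) : window β i < window β j := by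
    have hne : i ≠ j := fun e => by subst e; omega
    refine lt_of_le_of_ne (not_lt.1 fun hlt => ?_) fun e =>
      hne (abs_window_injective β (congrArg abs e))
    exact (moment_lt_mul_swapPos (s := ⟨_, swapPos_mem⟩) hij rfl hlt).not_ge
      (h _ (mem_simpleReflectionsD.2 (Or.inl ⟨i, j, hij, rfl⟩)))
  have hmono : StrictMono (window β) := by
    cases n with
    | zero => exact fun i => i.elim0
    | succ n => exact Fin.strictMono_iff_lt_succ.2 fun i => hstep _ _ (by simp)
  have hpos' (i : Fin n) (hi : (i : ℕ) ≠ 0) : 0 < window β i := by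
    let a : Fin n := ⟨0, by omega⟩
    let b : Fin n := ⟨1, by omega⟩
    have hab : a ≠ b := by simp [a, b]
    have hb : window β b ≤ window β i := hmono.monotone (Fin.le_def.2 (by simp [b]; omega))
    have h1 := hstep a b rfl
    have h2 : ¬ window β a + window β b < 0 := fun hlt =>
      (moment_lt_mul_swapNeg (s := ⟨_, swapNeg_mem hab⟩) rfl rfl rfl hlt).not_ge
        (h _ (mem_simpleReflectionsD.2 (Or.inr ⟨a, b, rfl, rfl, rfl⟩)))
    omega
  -- Only `β(1)` could be negative, and then it would be the only negative entry.
  have hpos (i : Fin n) : 0 < window β i := by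
    by_cases hi : (i : ℕ) = 0
    swap
    · exact hpos' i hi
    by_contra hlt
    have hneg : window β i < 0 := lt_of_le_of_ne (not_lt.1 hlt) (window_bounds β i).1
    have : (Finset.univ.filter fun k : Fin n => window β k < 0) = {i} := by
      ext k
      simp only [Finset.mem_filter, Finset.mem_univ, true_and, Finset.mem_singleton]
      refine ⟨fun hk => Fin.ext ?_, fun hk => hk ▸ hneg⟩
      by_contra hne
      have := hpos' k (by omega)
      omega
    rw [negCount, this] at hβ
    simp at hβ
  -- An increasing permutation of a finite chain is the identity.
  have habs : StrictMono (absPerm β) := fun i j hij => by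
    have h1 := coe_absPerm β i
    have h2 := coe_absPerm β j
    rw [abs_of_pos (hpos _)] at h1 h2
    have := hmono hij
    rw [Fin.lt_def]
    omega
  have hid : ∀ i, absPerm β i = i := fun i => by
    have : habs.orderIsoOfSurjective _ (absPerm β).surjective = OrderIso.refl _ :=
      Subsingleton.elim _ _
    exact congrArg (fun e : Fin n ≃o Fin n => e i) this
  apply window_injective
  funext i
  rw [window_one, ← abs_of_pos (hpos i), ← coe_absPerm, hid]

/-- The elements of `D_n` are products of generators. -/
lemma exists_prod_eq {β : Hyperoctahedral n} (hβ : Even (negCount (window β))) :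
    ∃ w : List (Hyperoctahedral n), (∀ s ∈ w, s ∈ simpleReflectionsD n) ∧ w.prod = β := by
  -- An element of maximal moment in the coset of `β` modulo the generated subgroup.
  let H := Submonoid.closure (simpleReflectionsD n)
  obtain ⟨h, hh, hmax⟩ := Set.exists_max_image (H : Set (Hyperoctahedral n))
    (fun h => moment (β * h)) (Set.toFinite _) ⟨1, H.one_mem⟩
  have heven : ∀ h ∈ H, Even (negCount (window (β * h))) := fun h hh => by
    induction hh using Submonoid.closure_induction_right with
    | one => simpa using hβ
    | mul_right x hx y hy ih => rw [← mul_assoc, even_negCount_mul hy]; exact ih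
  have h1 : β * h = 1 := eq_one_of_moment_le (heven h hh) fun s hs => by
    rw [mul_assoc]
    exact hmax _ (H.mul_mem hh (Submonoid.subset_closure hs))
  -- In a finite group the inverse of `h` is a power of `h`.
  have hmem : β ∈ H := by
    rw [eq_inv_of_mul_eq_one_left h1]
    obtain ⟨k, hk⟩ := (isOfFinOrder_of_finite h).mem_powers_iff_mem_zpowers.2
      (Subgroup.inv_mem _ (Subgroup.mem_zpowers h))
    rw [← hk]
    exact H.pow_mem hh k
  exact Submonoid.exists_list_of_mem_closure hmem

/-- The parity of the length of `γ ∈ D_n` is the sign of the permutation `|γ|`. -/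
lemma neg_one_pow_lengthD {γ : Hyperoctahedral n} (hγ : γ ∈ evenSigned n) :
    (-1 : ℤˣ) ^ lengthD γ = absSign γ := by
  obtain ⟨w, hw, rfl⟩ := exists_prod_eq (Finset.mem_filter.1 hγ).2
  obtain ⟨v, hv, hprod, hlen⟩ := Nat.sInf_mem (s := {k : ℕ | ∃ v : List (Hyperoctahedral n),
    (∀ s ∈ v, s ∈ simpleReflectionsD n) ∧ v.prod = w.prod ∧ v.length = k}) ⟨_, w, hw, rfl, rfl⟩
  rw [lengthD, ← hlen, ← absSign_prod v hv, hprod]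

end Hyperoctahedral

namespace Hyperoctahedral

open SignedIndex

/-! ### Signed permutations from their windows -/

section OfWindow

variable {n : ℕ}

/-- A sequence is a window of `B_n` if its entries are nonzero, lie in `[-n, n]`, and have
distinct absolute values. -/
def IsWindow (σ : Fin n → ℤ) : Prop :=
  (∀ i, σ i ≠ 0 ∧ -(n : ℤ) ≤ σ i ∧ σ i ≤ n) ∧ Function.Injective fun i => |σ i|

lemma isWindow_window (β : Hyperoctahedral n) : IsWindow (window β) :=
  ⟨window_bounds β, abs_window_injective β⟩

/-- The odd extension to `[-n, n] \ {0}` of a sequence of nonzero integers in `[-n, n]`. -/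
def oddExtension (σ : Fin n → ℤ) (hσ : ∀ i, σ i ≠ 0 ∧ -(n : ℤ) ≤ σ i ∧ σ i ≤ n)
    (x : SignedIndex n) : SignedIndex n :=
  ⟨if 0 < x.1 then σ (idx x) else -σ (idx x), by
    have := hσ (idx x)
    simp only [Finset.mem_erase, Finset.mem_Icc, ne_eq]
    split_ifs <;> omega⟩

lemma oddExtension_injective {σ : Fin n → ℤ} (hσ : IsWindow σ) :
    Function.Injective (oddExtension σ hσ.1) := by
  intro x y h
  have h' : (if 0 < x.1 then σ (idx x) else -σ (idx x)) =
      if 0 < y.1 then σ (idx y) else -σ (idx y) := congrArg Subtype.val h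
  have hidx : idx x = idx y := by
    apply hσ.2
    have := congrArg abs h'
    split_ifs at this <;> simpa only [abs_neg] using this
  have h0 := (hσ.1 (idx y)).1
  have hx := x.bounds
  have hy := y.bounds
  have hxi := x.coe_idx
  have hyi := y.coe_idx
  rw [hidx] at h' hxi
  rw [Int.abs_eq_natAbs] at hxi hyi
  apply Subtype.ext
  split_ifs at h' <;> omega

/-- The signed permutation with a given window. -/
noncomputable def ofWindow (σ : Fin n → ℤ) (hσ : IsWindow σ) : Hyperoctahedral n :=
  ⟨Equiv.ofBijective _ (Finite.injective_iff_bijective.1 (oddExtension_injective hσ)), fun x => by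
    have := x.bounds
    apply Subtype.ext
    simp only [Equiv.ofBijective_apply, oddExtension, coe_neg, idx_neg]
    split_ifs
    · omega
    · rw [neg_neg]
    · rfl
    · omega⟩

@[simp] lemma window_ofWindow (σ : Fin n → ℤ) (hσ : IsWindow σ) : window (ofWindow σ hσ) = σ := by
  funext i
  have : (0 : ℤ) < (i : ℤ) + 1 := by positivity
  change (if (0 : ℤ) < (i : ℤ) + 1 then σ (idx (pos i)) else _) = _
  rw [if_pos this, idx_pos]

lemma eq_of_window {β γ : Hyperoctahedral n} (h : ∀ i, window β i = window γ i) : β = γ :=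
  window_injective (funext h)

end OfWindow

/-! ### The flag-major index under rotation of the values -/

variable {m : ℕ}

lemma flagMaj_succ (σ : Fin (m + 1) → ℤ) :
    flagMaj σ = ∑ i : Fin m, if FlagLT (σ i.succ) (σ i.castSucc) then (i : ℕ) + 1 else 0 := by
  rw [flagMaj, flagDescents, Finset.sum_filter, Fin.sum_univ_castSucc, if_neg, add_zero]
  · refine Finset.sum_congr rfl fun i _ => ?_
    refine if_congr ⟨?_, fun h => ⟨i.succ, by simp, h⟩⟩ rfl rfl
    rintro ⟨j, hj, h⟩
    rwa [show j = i.succ from Fin.ext (by simpa using hj)] at h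
  · rintro ⟨j, hj, -⟩
    have := j.2
    rw [Fin.val_last] at hj
    omega

/-- The cyclic rotation `1 ↦ 2 ↦ ⋯ ↦ n ↦ -1 ↦ -2 ↦ ⋯ ↦ -n ↦ 1` of the letters. -/
def rotVal (n : ℕ) (z : ℤ) : ℤ :=
  if z = n then -1 else if z = -n then 1 else if 0 < z then z + 1 else z - 1

/-- The inverse of `rotVal n` on `[-n, n] \ {0}`. -/
def rotValInv (n : ℕ) (z : ℤ) : ℤ :=
  if z = -1 then n else if z = 1 then -n else if 0 < z then z - 1 else z + 1

lemma rotValInv_rotVal {n : ℕ} {z : ℤ} (hz : z ≠ 0 ∧ -(n : ℤ) ≤ z ∧ z ≤ n) :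
    rotValInv n (rotVal n z) = z := by
  simp only [rotVal, rotValInv]
  grind

lemma rotVal_rotValInv {n : ℕ} {z : ℤ} (hz : z ≠ 0 ∧ -(n : ℤ) ≤ z ∧ z ≤ n) :
    rotVal n (rotValInv n z) = z := by
  simp only [rotVal, rotValInv]
  grind

lemma isWindow_rotVal {n : ℕ} {σ : Fin n → ℤ} (hσ : IsWindow σ) :
    IsWindow fun i => rotVal n (σ i) := by
  refine ⟨fun i => ?_, fun i j h => hσ.2 ?_⟩
  · have := hσ.1 i
    have := i.2
    simp only [rotVal]
    split_ifs <;> omega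
  · have := hσ.1 i
    have := hσ.1 j
    simp only [rotVal, Int.abs_eq_natAbs] at h ⊢
    split_ifs at h <;> omega

lemma isWindow_rotValInv {n : ℕ} {σ : Fin n → ℤ} (hσ : IsWindow σ) :
    IsWindow fun i => rotValInv n (σ i) := by
  refine ⟨fun i => ?_, fun i j h => hσ.2 ?_⟩
  · have := hσ.1 i
    have := i.2
    simp only [rotValInv]
    split_ifs <;> omega
  · have := hσ.1 i
    have := hσ.1 j
    simp only [rotValInv, Int.abs_eq_natAbs] at h ⊢
    split_ifs at h <;> omega

/-- The rotation is increasing for `≺` except that it moves the greatest letter `n` to the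
least letter `-1`. -/
lemma flagLT_rotVal {n : ℕ} {a b : ℤ} (ha : a ≠ 0 ∧ -(n : ℤ) ≤ a ∧ a ≤ n)
    (hb : b ≠ 0 ∧ -(n : ℤ) ≤ b ∧ b ≤ n) (hab : a ≠ b) :
    (if FlagLT (rotVal n b) (rotVal n a) then (1 : ℤ) else 0) =
      (if FlagLT b a then 1 else 0) + (if b = n then 1 else 0) - if a = n then 1 else 0 := by
  have h (p : Prop) [Decidable p] : (if p then (1 : ℤ) else 0) = 1 ∧ p ∨
      (if p then (1 : ℤ) else 0) = 0 ∧ ¬p := by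
    by_cases hp : p <;> simp [hp]
  have h1 := h (FlagLT (rotVal n b) (rotVal n a))
  have h2 := h (FlagLT b a)
  have h3 := h (b = n)
  have h4 := h (a = n)
  simp only [FlagLT, rotVal] at *
  grind

lemma natCast_flagMaj_succ (σ : Fin (m + 1) → ℤ) : (flagMaj σ : ℤ) =
    ∑ i : Fin m, ((i : ℤ) + 1) * if FlagLT (σ i.succ) (σ i.castSucc) then 1 else 0 := by
  rw [flagMaj_succ]
  push_cast
  exact Finset.sum_congr rfl fun i _ => by simp

/-- Rotating the values lowers `fmaj` by one, unless the last entry is the greatest letter. -/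
lemma fmaj_rotVal {σ : Fin (m + 1) → ℤ} (hσ : IsWindow σ) {p : Fin (m + 1)}
    (hp : |σ p| = (m : ℤ) + 1) (hlast : σ (Fin.last m) ≠ (m : ℤ) + 1) :
    fmaj σ = fmaj (fun i => rotVal (m + 1) (σ i)) + 1 := by
  -- `P` and `N` mark the position of the letter of absolute value `m + 1`, according to its sign.
  let P (i : Fin (m + 1)) : ℤ := if σ i = (m : ℤ) + 1 then 1 else 0
  let N (i : Fin (m + 1)) : ℤ := if σ i = -((m : ℤ) + 1) then 1 else 0
  have hmaj : (flagMaj (fun i => rotVal (m + 1) (σ i)) : ℤ) = flagMaj σ - ∑ i, P i := by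
    -- Moving the greatest letter at the (one-based) position `p` to the bottom trades the descent
    -- at `p` for one at `p - 1`; the case `p = 1` needs no exception, as the position is then `0`.
    have h1 : ∑ i : Fin m, ((i : ℤ) + 1) * P i.succ = ∑ i : Fin (m + 1), (i : ℤ) * P i := by
      rw [Fin.sum_univ_succ]
      simp
    have h2 : ∑ i : Fin m, ((i : ℤ) + 1) * P i.castSucc =
        ∑ i : Fin (m + 1), ((i : ℤ) + 1) * P i := by
      rw [Fin.sum_univ_castSucc (fun i => ((i : ℤ) + 1) * P i)]
      simp [P, hlast]
    have h3 : ∑ i, P i =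
        ∑ i : Fin (m + 1), ((i : ℤ) + 1) * P i - ∑ i : Fin (m + 1), (i : ℤ) * P i := by
      rw [← Finset.sum_sub_distrib]
      exact Finset.sum_congr rfl fun i _ => by ring
    rw [h3, ← h1, ← h2, natCast_flagMaj_succ, natCast_flagMaj_succ, ← Finset.sum_sub_distrib,
      ← Finset.sum_sub_distrib]
    refine Finset.sum_congr rfl fun i _ => ?_
    rw [flagLT_rotVal (hσ.1 _) (hσ.1 _) fun e =>
      i.castSucc_lt_succ.ne (hσ.2 (congrArg abs e))]
    simp only [P]
    push_cast
    ring
  have hneg : (negCount (fun i => rotVal (m + 1) (σ i)) : ℤ) =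
      negCount σ + ∑ i, P i - ∑ i, N i := by
    rw [natCast_negCount, natCast_negCount, ← Finset.sum_add_distrib, ← Finset.sum_sub_distrib]
    refine Finset.sum_congr rfl fun i _ => ?_
    have := hσ.1 i
    simp only [rotVal, P, N]
    push_cast at this ⊢
    split_ifs <;> omega
  -- `fmaj` changes by `-2 ∑ P + ∑ P - ∑ N = -(∑ P + ∑ N)`.
  have hone : ∑ i, P i + ∑ i, N i = 1 := by
    rw [← Finset.sum_add_distrib, Finset.sum_eq_single p]
    · simp only [P, N]
      rw [Int.abs_eq_natAbs] at hp
      split_ifs <;> omega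
    · intro i _ hi
      have : |σ i| ≠ |σ p| := hσ.2.ne hi
      rw [hp, Int.abs_eq_natAbs] at this
      simp only [P, N]
      split_ifs <;> omega
    · simp
  have : (fmaj σ : ℤ) = fmaj (fun i => rotVal (m + 1) (σ i)) + 1 := by
    rw [fmaj, fmaj]
    push_cast
    linarith
  exact_mod_cast this

/-- A last entry exceeding all others in `≺` does not contribute to `fmaj`. -/
lemma fmaj_snoc {σ : Fin m → ℤ} {z : ℤ} (hz : 0 < z) (hσ : ∀ i, σ i < z) :
    fmaj (Fin.snoc σ z : Fin (m + 1) → ℤ) = fmaj σ := by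
  have hmaj : flagMaj (Fin.snoc σ z : Fin (m + 1) → ℤ) = flagMaj σ := by
    cases m with
    | zero => rw [flagMaj_succ, flagMaj, Finset.univ_eq_empty, Finset.sum_empty,
        Finset.eq_empty_of_isEmpty (flagDescents σ), Finset.sum_empty]
    | succ m =>
      rw [flagMaj_succ, flagMaj_succ, Fin.sum_univ_castSucc, if_neg, add_zero]
      · refine Finset.sum_congr rfl fun i _ => ?_
        rw [Fin.snoc_castSucc, Fin.succ_castSucc, Fin.snoc_castSucc]
        rfl
      · rw [Fin.succ_last, Fin.snoc_last, Fin.snoc_castSucc, FlagLT]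
        have := hσ (Fin.last m)
        split_ifs <;> omega
  have hneg : negCount (Fin.snoc σ z : Fin (m + 1) → ℤ) = negCount σ := by
    zify
    rw [natCast_negCount, natCast_negCount, Fin.sum_univ_castSucc]
    simp [hz.not_gt]
  rw [fmaj, fmaj, hmaj, hneg]

/-! ### The signed enumerator by last entry -/

/-- The term `sgn |β| q ^ fmaj β`. -/
noncomputable def weight {n : ℕ} (β : Hyperoctahedral n) : ℤ[X] :=
  ((absSign β : ℤ) : ℤ[X]) * X ^ fmaj (window β)

/-- The signed enumerator of `fmaj` on `B_n`. -/
noncomputable def signedSum (n : ℕ) : ℤ[X] := ∑ β : Hyperoctahedral n, weight β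

/-- The signed enumerator of `fmaj` on the elements with a given last entry. -/
noncomputable def lastSum (m : ℕ) (z : ℤ) : ℤ[X] :=
  ∑ β : Hyperoctahedral (m + 1) with window β (Fin.last m) = z, weight β

/-- The product `c * β`, where `c` is the rotation `rotVal n` of the letters. -/
noncomputable def rotate {n : ℕ} (β : Hyperoctahedral n) : Hyperoctahedral n :=
  ofWindow _ (isWindow_rotVal (isWindow_window β))

/-- The product `c⁻¹ * β`, where `c` is the rotation `rotVal n` of the letters. -/
noncomputable def rotateInv {n : ℕ} (β : Hyperoctahedral n) : Hyperoctahedral n :=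
  ofWindow _ (isWindow_rotValInv (isWindow_window β))

lemma window_rotate {n : ℕ} (β : Hyperoctahedral n) (i : Fin n) :
    window (rotate β) i = rotVal n (window β i) := by rw [rotate, window_ofWindow]

lemma window_rotateInv {n : ℕ} (β : Hyperoctahedral n) (i : Fin n) :
    window (rotateInv β) i = rotValInv n (window β i) := by rw [rotateInv, window_ofWindow]

/-- On absolute values the rotation of the letters is an `(m + 1)`-cycle. -/
lemma absSign_rotate (β : Hyperoctahedral (m + 1)) :
    absSign (rotate β) = (-1) ^ m * absSign β := by
  have h : absPerm (rotate β) = finRotate (m + 1) * absPerm β := by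
    ext i
    rw [Equiv.Perm.mul_apply, finRotate_apply, Fin.val_add_one]
    have h1 := coe_absPerm (rotate β) i
    have h2 := coe_absPerm β i
    have h3 := window_bounds β i
    have h4 := (absPerm β i).2
    rw [window_rotate, rotVal] at h1
    simp only [Fin.ext_iff, Fin.val_last]
    push_cast at h1 h3
    rw [Int.abs_eq_natAbs] at h1 h2
    split_ifs at h1 ⊢ <;> omega
  rw [absSign_apply, h, map_mul, sign_finRotate, absSign_apply, Nat.add_sub_cancel]

lemma exists_abs_window_eq (β : Hyperoctahedral (m + 1)) :
    ∃ p, |window β p| = (m : ℤ) + 1 := by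
  obtain ⟨p, hp⟩ := (absPerm β).surjective (Fin.last m)
  exact ⟨p, by rw [← coe_absPerm, hp, Fin.val_last]⟩

lemma weight_rotate (β : Hyperoctahedral (m + 1))
    (h : window β (Fin.last m) ≠ (m : ℤ) + 1) :
    weight β = (-1) ^ m * X * weight (rotate β) := by
  obtain ⟨p, hp⟩ := exists_abs_window_eq β
  have hm : ((-1 : ℤ[X]) ^ m) * (-1) ^ m = 1 := by rw [← mul_pow]; simp
  rw [weight, weight, absSign_rotate, fmaj_rotVal (isWindow_window β) hp h, rotate,
    window_ofWindow]
  push_cast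
  linear_combination (-(((absSign β : ℤ) : ℤ[X]) *
    X ^ (fmaj (fun i => rotVal (m + 1) (window β i)) + 1))) * hm

/-- Rotation identifies the fibre over `z` with the fibre over the next letter. -/
lemma lastSum_rotVal {z : ℤ} (hz0 : z ≠ 0) (hz1 : -((m : ℤ) + 1) ≤ z) (hz2 : z < (m : ℤ) + 1) :
    lastSum m z = (-1) ^ m * X * lastSum m (rotVal (m + 1) z) := by
  rw [lastSum, lastSum, Finset.mul_sum]
  refine Finset.sum_nbij' rotate rotateInv ?_ ?_ ?_ ?_ ?_
  · intro β hβ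
    simp only [Finset.mem_filter, Finset.mem_univ, true_and] at hβ ⊢
    rw [window_rotate, hβ]
  · intro β hβ
    simp only [Finset.mem_filter, Finset.mem_univ, true_and] at hβ ⊢
    rw [window_rotateInv, hβ, rotValInv_rotVal (by push_cast; omega)]
  · intro β _
    refine eq_of_window fun i => ?_
    rw [window_rotateInv, window_rotate, rotValInv_rotVal (window_bounds β i)]
  · intro β _
    refine eq_of_window fun i => ?_
    rw [window_rotate, window_rotateInv, rotVal_rotValInv (window_bounds β i)]
  · intro β hβ
    refine weight_rotate β ?_
    rw [(Finset.mem_filter.1 hβ).2]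
    exact hz2.ne

lemma isWindow_snoc (β : Hyperoctahedral m) :
    IsWindow (Fin.snoc (window β) ((m : ℤ) + 1) : Fin (m + 1) → ℤ) := by
  refine ⟨fun i => ?_, fun i j h => ?_⟩
  · push_cast
    induction i using Fin.lastCases with
    | last => rw [Fin.snoc_last]; omega
    | cast i => rw [Fin.snoc_castSucc]; have := window_bounds β i; omega
  · induction i using Fin.lastCases with
    | last =>
      induction j using Fin.lastCases with
      | last => rfl
      | cast j =>
        simp only [Fin.snoc_last, Fin.snoc_castSucc, Int.abs_eq_natAbs] at h
        have := window_bounds β j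
        omega
    | cast i =>
      induction j using Fin.lastCases with
      | last =>
        simp only [Fin.snoc_last, Fin.snoc_castSucc, Int.abs_eq_natAbs] at h
        have := window_bounds β i
        omega
      | cast j =>
        simp only [Fin.snoc_castSucc] at h
        exact congrArg _ (abs_window_injective β h)

lemma isWindow_init {β : Hyperoctahedral (m + 1)} (hβ : window β (Fin.last m) = (m : ℤ) + 1) :
    IsWindow fun i : Fin m => window β i.castSucc := by
  refine ⟨fun i => ?_, fun i j h =>
    Fin.castSucc_injective m (abs_window_injective β h)⟩
  have h1 := window_bounds β i.castSucc
  have h2 : |window β i.castSucc| ≠ |window β (Fin.last m)| :=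
    (abs_window_injective β).ne i.castSucc_lt_last.ne
  push_cast at h1
  rw [hβ, Int.abs_eq_natAbs, Int.abs_eq_natAbs] at h2
  beta_reduce
  omega

/-- The image of `β` under the embedding of `B_m` into `B_{m+1}` as the stabiliser of `m + 1`. -/
noncomputable def extendFixed (β : Hyperoctahedral m) : Hyperoctahedral (m + 1) :=
  ofWindow _ (isWindow_snoc β)

lemma absSign_extendFixed (β : Hyperoctahedral m) : absSign (extendFixed β) = absSign β := by
  have h : absPerm (extendFixed β) =
      (finSuccEquivLast (n := m)).symm.permCongr (Equiv.optionCongr (absPerm β)) := by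
    ext i
    zify
    rw [← add_left_inj (1 : ℤ), coe_absPerm, extendFixed, window_ofWindow]
    induction i using Fin.lastCases with
    | last =>
      rw [Fin.snoc_last, abs_of_pos (by positivity)]
      simp [Equiv.permCongr_apply]
    | cast i =>
      rw [Fin.snoc_castSucc, ← coe_absPerm]
      simp [Equiv.permCongr_apply]
  rw [absSign_apply, h, Equiv.Perm.sign_permCongr, Equiv.optionCongr_sign, absSign_apply]

/-- The fibre over the greatest letter contributes the enumerator of `B_m`. -/
lemma lastSum_top : lastSum m ((m : ℤ) + 1) = signedSum m := by
  rw [lastSum, signedSum]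
  symm
  refine Finset.sum_bij (fun β _ => extendFixed β) ?_ ?_ ?_ ?_
  · intro β _
    simp [extendFixed]
  · intro β _ γ _ h
    refine eq_of_window fun i => ?_
    have := congrArg (fun δ => window δ i.castSucc) h
    simpa [extendFixed] using this
  · intro β hβ
    have hβ' := (Finset.mem_filter.1 hβ).2
    refine ⟨ofWindow _ (isWindow_init hβ'), Finset.mem_univ _, eq_of_window fun i => ?_⟩
    induction i using Fin.lastCases with
    | last => simp [extendFixed, hβ']
    | cast i => simp [extendFixed]
  · intro β _
    rw [weight, weight, absSign_extendFixed, extendFixed, window_ofWindow, fmaj_snoc]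
    · positivity
    · intro i
      have := window_bounds β i
      omega

/-- The letter in position `k` of the list `n, n - 1, …, 1, -n, -(n - 1), …, -1`, the orbit of
`n` under the inverse rotation. -/
def orbitLetter (n k : ℕ) : ℤ := if k < n then (n : ℤ) - k else (k : ℤ) - 2 * n

/-- Each step along the orbit multiplies the signed sum over the fibre by `(-1) ^ m * X`. -/
lemma lastSum_orbitLetter {k : ℕ} (hk : k < 2 * (m + 1)) :
    lastSum m (orbitLetter (m + 1) k) = ((-1) ^ m * X) ^ k * signedSum m := by
  induction k with
  | zero => rw [← lastSum_top]; simp [orbitLetter]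
  | succ k ih =>
    have h : rotVal (m + 1) (orbitLetter (m + 1) (k + 1)) = orbitLetter (m + 1) k := by
      simp only [rotVal, orbitLetter]
      push_cast
      split_ifs <;> omega
    rw [lastSum_rotVal, h, ih (by omega), pow_succ]
    · ring
    all_goals
      simp only [orbitLetter]
      push_cast
      split_ifs <;> omega

/-- Summing over the first `r` letters `n, n - 1, …` of the orbit as last entries gives
the first `r` powers of `(-1) ^ m * X`. -/
lemma sum_lastSum (s : Finset (Hyperoctahedral (m + 1))) {r : ℕ} (hr : r ≤ 2 * (m + 1))
    (hs : ∀ β, β ∈ s ↔ ∃ k < r, window β (Fin.last m) = orbitLetter (m + 1) k) :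
    ∑ β ∈ s, weight β = signedSum m * qInt r ((-1) ^ m * X) := by
  have hinj : Set.InjOn (orbitLetter (m + 1)) (Finset.range r) := by
    intro a ha b hb h
    simp only [Finset.coe_range, Set.mem_Iio] at ha hb
    simp only [orbitLetter] at h
    push_cast at h
    split_ifs at h <;> omega
  rw [← Finset.sum_fiberwise_of_maps_to (t := (Finset.range r).image (orbitLetter (m + 1)))
    (g := fun β => window β (Fin.last m)), Finset.sum_image hinj, qInt, Finset.mul_sum]
  · refine Finset.sum_congr rfl fun k hk => ?_
    have hk' := Finset.mem_range.1 hk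
    rw [mul_comm, ← lastSum_orbitLetter (by omega), lastSum]
    refine Finset.sum_congr (Finset.ext fun β => ?_) fun _ _ => rfl
    simp only [Finset.mem_filter, Finset.mem_univ, true_and, and_iff_right_iff_imp]
    exact fun h => (hs β).2 ⟨k, hk', h⟩
  · intro β hβ
    obtain ⟨k, hk, h⟩ := (hs β).1 hβ
    exact Finset.mem_image.2 ⟨k, Finset.mem_range.2 hk, h.symm⟩

lemma signedSum_succ (m : ℕ) :
    signedSum (m + 1) = signedSum m * qInt (2 * (m + 1)) ((-1) ^ m * X) := by
  refine sum_lastSum _ le_rfl fun β => ?_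
  simp only [Finset.mem_univ, true_iff]
  have h := window_bounds β (Fin.last m)
  push_cast at h
  rcases lt_or_gt_of_ne h.1 with h0 | h0
  · refine ⟨(2 * (m + 1) + window β (Fin.last m)).toNat, by omega, ?_⟩
    rw [orbitLetter]
    split_ifs <;> omega
  · refine ⟨(m + 1 - window β (Fin.last m)).toNat, by omega, ?_⟩
    rw [orbitLetter]
    split_ifs <;> omega

lemma sum_weight_last_pos (m : ℕ) :
    ∑ β : Hyperoctahedral (m + 1) with 0 < window β (Fin.last m), weight β =
      signedSum m * qInt (m + 1) ((-1) ^ m * X) := by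
  refine sum_lastSum _ (by omega) fun β => ?_
  simp only [Finset.mem_filter, Finset.mem_univ, true_and]
  have h := window_bounds β (Fin.last m)
  push_cast at h
  constructor
  · intro h0
    refine ⟨(m + 1 - window β (Fin.last m)).toNat, by omega, ?_⟩
    rw [orbitLetter]
    split_ifs <;> omega
  · rintro ⟨k, hk, h⟩
    rw [h, orbitLetter, if_pos hk]
    omega

/-- The signed Mahonian formula for `B_n`. -/
lemma signedSum_eq_prod (n : ℕ) :
    signedSum n = ∏ k ∈ Finset.range n, qInt (2 * (k + 1)) ((-1) ^ k * X : ℤ[X]) := by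
  induction n with
  | zero =>
    have : Subsingleton (Hyperoctahedral 0) := ⟨fun a b => eq_of_window fun i => i.elim0⟩
    rw [signedSum, Finset.prod_range_zero, Fintype.sum_subsingleton _ 1]
    rw [weight, fmaj, flagMaj, negCount, Finset.eq_empty_of_isEmpty (flagDescents _),
      Finset.eq_empty_of_isEmpty (Finset.filter _ _)]
    simp
  | succ n ih => rw [signedSum_succ, ih, Finset.prod_range_succ]

/-! ### From `D_n` to positive last entries -/

lemma isWindow_snoc_neg (β : Hyperoctahedral (m + 1)) :
    IsWindow (Fin.snoc (fun i => window β i.castSucc) (-window β (Fin.last m)) :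
      Fin (m + 1) → ℤ) := by
  set σ : Fin (m + 1) → ℤ := Fin.snoc (fun i => window β i.castSucc) (-window β (Fin.last m))
  have h (i : Fin (m + 1)) : σ i = window β i ∨ σ i = -window β i := by
    induction i using Fin.lastCases with
    | last => right; simp [σ]
    | cast i => left; simp [σ]
  have h' (i : Fin (m + 1)) : |σ i| = |window β i| := by
    rcases h i with h | h <;> rw [h]
    rw [abs_neg]
  refine ⟨fun i => ?_, ?_⟩
  · have := window_bounds β i
    rcases h i with h | h <;> omega
  · simp only [h']
    exact abs_window_injective β

/-- The signed permutation obtained by changing the sign of the last window entry. -/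
noncomputable def flipLast (β : Hyperoctahedral (m + 1)) : Hyperoctahedral (m + 1) :=
  ofWindow _ (isWindow_snoc_neg β)

@[simp] lemma window_flipLast_castSucc (β : Hyperoctahedral (m + 1)) (i : Fin m) :
    window (flipLast β) i.castSucc = window β i.castSucc := by simp [flipLast]

@[simp] lemma window_flipLast_last (β : Hyperoctahedral (m + 1)) :
    window (flipLast β) (Fin.last m) = -window β (Fin.last m) := by simp [flipLast]

@[simp] lemma flipLast_flipLast (β : Hyperoctahedral (m + 1)) : flipLast (flipLast β) = β := by
  refine eq_of_window fun i => ?_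
  induction i using Fin.lastCases <;> simp

@[simp] lemma absSign_flipLast (β : Hyperoctahedral (m + 1)) :
    absSign (flipLast β) = absSign β := by
  rw [absSign_apply, absSign_apply]
  congr 1
  ext i
  zify
  rw [← add_left_inj (1 : ℤ), coe_absPerm, coe_absPerm]
  induction i using Fin.lastCases <;> simp

lemma even_negCount_flipLast (β : Hyperoctahedral (m + 1)) :
    Even (negCount (window (flipLast β))) ↔ ¬Even (negCount (window β)) := by
  have h0 := (window_bounds β (Fin.last m)).1
  rw [← Int.even_coe_nat, ← Int.even_coe_nat, natCast_negCount, natCast_negCount,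
    Fin.sum_univ_castSucc, Fin.sum_univ_castSucc]
  simp only [window_flipLast_castSucc, window_flipLast_last, Int.even_iff]
  split_ifs <;> omega

/-- Making the last entry positive turns `Dmaj` into `fmaj` and keeps `|γ|`. -/
lemma weight_ite_flipLast (γ : Hyperoctahedral (m + 1)) (hγ : γ ∈ evenSigned (m + 1)) :
    (-1 : ℤ[X]) ^ lengthD γ * X ^ Dmaj γ =
      weight (if 0 < window γ (Fin.last m) then γ else flipLast γ) := by
  have hsign : (-1 : ℤ[X]) ^ lengthD γ = ((absSign γ : ℤ) : ℤ[X]) := by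
    rw [← neg_one_pow_lengthD hγ]
    push_cast
    rfl
  have hw : absLast (window γ) =
      window (if 0 < window γ (Fin.last m) then γ else flipLast γ) := by
    funext i
    induction i using Fin.lastCases with
    | last =>
      simp only [absLast, Fin.val_last, if_true]
      split_ifs with h
      · exact abs_of_pos h
      · rw [window_flipLast_last, abs_of_nonpos (not_lt.1 h)]
    | cast i =>
      have : (i : ℕ) + 1 ≠ m + 1 := by omega
      simp only [absLast, Fin.val_castSucc, if_neg this]
      split_ifs <;> simp
  rw [weight, Dmaj, hw, hsign]
  split_ifs <;> simp

/-- The map making the last entry positive is a bijection from `D_n` onto the elements of `B_n`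
with positive last entry. -/
lemma sum_evenSigned (m : ℕ) :
    ∑ γ ∈ evenSigned (m + 1), (-1 : ℤ[X]) ^ lengthD γ * X ^ Dmaj γ =
      ∑ β : Hyperoctahedral (m + 1) with 0 < window β (Fin.last m), weight β := by
  refine Finset.sum_nbij' (fun γ => if 0 < window γ (Fin.last m) then γ else flipLast γ)
    (fun β => if Even (negCount (window β)) then β else flipLast β) ?_ ?_ ?_ ?_
    weight_ite_flipLast
  · intro γ _
    have := (window_bounds γ (Fin.last m)).1
    simp only [Finset.mem_filter, Finset.mem_univ, true_and]
    split_ifs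
    · assumption
    · rw [window_flipLast_last]
      omega
  · intro β _
    simp only [evenSigned, Finset.mem_filter, Finset.mem_univ, true_and]
    split_ifs with h
    · exact h
    · exact (even_negCount_flipLast β).2 h
  · intro γ hγ
    have h := (Finset.mem_filter.1 hγ).2
    by_cases h0 : 0 < window γ (Fin.last m)
    · simp only [if_pos h0, if_pos h]
    · simp only [if_neg h0, even_negCount_flipLast, h, not_true, if_false, flipLast_flipLast]
  · intro β hβ
    have h := (Finset.mem_filter.1 hβ).2
    by_cases h0 : Even (negCount (window β))
    · simp only [if_pos h0, if_pos h]
    · simp only [if_neg h0, window_flipLast_last, flipLast_flipLast, neg_pos, h.not_gt, if_false]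

end Hyperoctahedral

/-! ### Comparison of the two products -/

lemma qInt_two_mul {R : Type*} [CommRing R] (k : ℕ) (y : R) :
    qInt (2 * k) y = (1 + y) * qInt k (y ^ 2) := by
  simp only [qInt]
  induction k with
  | zero => simp
  | succ k ih =>
    rw [show 2 * (k + 1) = 2 * k + 1 + 1 by ring, Finset.sum_range_succ, Finset.sum_range_succ, ih,
      Finset.sum_range_succ, ← pow_mul]
    ring

/-- Exchanging `x` and `-x` in all factors leaves the product unchanged for an even number of
factors; in the odd case it only affects one factor `1 ± x`. -/
lemma prod_qInt_neg {R : Type*} [CommRing R] (x : R) (j : ℕ) :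
    ∏ k ∈ Finset.range (2 * j), qInt (2 * (k + 1)) ((-1) ^ k * x) =
      ∏ k ∈ Finset.range (2 * j), qInt (2 * (k + 1)) ((-1) ^ (k + 1) * x) := by
  induction j with
  | zero => simp
  | succ j ih =>
    have h : (-1 : R) ^ (2 * j) = 1 := by rw [pow_mul, neg_one_sq, one_pow]
    rw [show 2 * (j + 1) = 2 * j + 1 + 1 by ring]
    simp only [Finset.prod_range_succ, ih]
    simp only [pow_succ (-1 : R) (2 * j), pow_succ (-1 : R) (2 * j + 1), h]
    rw [one_mul, mul_neg_one, neg_one_mul, neg_mul_neg, one_mul, one_mul,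
      qInt_two_mul, qInt_two_mul, qInt_two_mul, qInt_two_mul, neg_sq]
    ring

lemma prod_qInt_mul_qInt {R : Type*} [CommRing R] (x : R) (m : ℕ) :
    (∏ k ∈ Finset.range m, qInt (2 * (k + 1)) ((-1) ^ k * x)) * qInt (m + 1) ((-1) ^ m * x) =
      (∏ k ∈ Finset.range m, qInt (2 * (k + 1)) ((-1) ^ (k + 1) * x)) * qInt (m + 1) x := by
  obtain ⟨j, rfl | rfl⟩ := m.even_or_odd'
  · rw [prod_qInt_neg, pow_mul, neg_one_sq, one_pow, one_mul]
  · rw [Finset.prod_range_succ, Finset.prod_range_succ, prod_qInt_neg,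
      show 2 * j + 1 + 1 = 2 * (j + 1) by ring]
    have h : ((-1 : R)) ^ (2 * j) = 1 := by rw [pow_mul, neg_one_sq, one_pow]
    rw [h, pow_succ, h, one_mul, one_mul, neg_one_mul, qInt_two_mul _ x, qInt_two_mul _ (-x),
      qInt_two_mul _ (-x), qInt_two_mul _ x, neg_sq]
    ring

theorem mainTheorem1 (n : ℕ) (hn : 1 ≤ n) :
    ∑ γ ∈ evenSigned n, (-1 : ℤ[X]) ^ lengthD γ * X ^ Dmaj γ =
      (∏ k ∈ Finset.Icc 1 (n - 1), qInt (2 * k) ((-1) ^ k * X : ℤ[X])) * qInt n (X : ℤ[X]) := by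
  obtain ⟨m, rfl⟩ := Nat.exists_eq_add_of_le' hn
  rw [Hyperoctahedral.sum_evenSigned, Hyperoctahedral.sum_weight_last_pos,
    Hyperoctahedral.signedSum_eq_prod, prod_qInt_mul_qInt, Nat.add_sub_cancel,
    Finset.range_eq_Ico, Finset.prod_Ico_add' (fun k => qInt (2 * k) ((-1) ^ k * X : ℤ[X])) 0 m 1]
  rfl
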